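/- Let $1\le n\le d$, let $\mathcal D$ be a probability distribution on $\mathbb R^d$, and let $f:\mathbb R^d\to\mathbb R$ be a generalized additive model (GAM) of order $n$, that is, $f(x)=\sum_{S\subset[d],\,|S|\le n}g_S(x_S)$ for all $x$ with some functions $g_S:\mathbb R^S\to\mathbb R$, where $x_S=(x_i)_{i\in S}$. For a value function $v(x,S)$, $x\in\mathbb R^d$, $S\subset[d]$, put $$\Delta_S(x)=\sum_{T\subset[d]\setminus S}\frac{(d-|T|-|S|)!\,|T|!}{(d-|S|+1)!}\sum_{L\subset S}(-1)^{|S|-|L|}v(x,L\cup T),$$ and define the $m$-Shapley Values $\Phi^m_S(x)$, $|S|\le m$, recursively by $\Phi^m_S=\Delta_S$ if $|S|=m$ and $$\Phi^m_S(x)=\Phi^{m-1}_S(x)+B_{m-|S|}\sum_{K\subset[d]\setminus S,\ |K|+|S|=m}\Delta_{S\cup K}(x)\quad\text{if }|S|<m,$$ where $B_k$ are the Bernoulli numbers with $B_1=-\tfrac12$. The Shapley-GAM of $v$ is the family of functions $f_S:\mathbb R^S\to\mathbb R$, $S\subset[d]$, with $f_S(x_S)=\Phi^d_S(x)$ for all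 $x$. Assume that either (a) $v$ is an observational SHAP value function of $f$, i.e. $f$ is integrable and each $v(\cdot,S)$ is a version of the conditional expectation $v(x,S)=\mathbb E_{z\sim\mathcal D}[f(z)\mid z_S=x_S]$ that is a Borel function of $x_S$, and the coordinates (features) are independent under $\mathcal D$; or (b) $v$ is the interventional SHAP value function $v(x,S)=\mathbb E_{z\sim\mathcal D}[f(x_S,z_{[d]\setminus S})]$, where these expectations exist for all $x$ and $S$. Then the Shapley-GAM exists, and for $\mathcal D$-almost every $x$ in case (a), respectively for every $x\in\mathbb R^d$ in case (b): $f(x)=\sum_{S\subset[d]}f_S(x_S)$; the Shapley-GAM has no components of order greater than $n$, i.e. $f_S(x_S)=0$ whenever $|S|>n$; and $$\Phi^n_S(x)=f_S(x_S)\quad\text{for every } S\subset[d]\text{ with }|S|\le n,$$ so that the $n$-Shapley Values represent $f$ as a GAM of order $n$: $f(x)=\sum_{|S|\le n}\Phi^n_S(x)$. In particular, ordinary Shapley Values recover the shape functions of Glassbox-GAMs: if $n=1$, then for the same $x$ the ordinary Shapley Value $\varphi_i(x)=\sum_{T\subset[d]\setminus\{i\}}\frac{|T|!\,(d-|T|-1)!}{d!}\big(v(x,T\cup\{i\})-v(x,T)\big)$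 of every feature $i$ equals $f_{\{i\}}(x_i)$, and whenever $f(x)=c+\sum_i g_i(x_i)$ for all $x$, each $g_i(z_i)$ is $\mathcal D$-integrable and $\varphi_i(x)=g_i(x_i)-\mathbb E_{z\sim\mathcal D}[g_i(z_i)]$. -/

import Mathlib

open MeasureTheory ProbabilityTheory

noncomputable section

namespace NShap

variable {d : ℕ}

/-- `f : ℝ^d → ℝ` is a generalized additive model of order `n`: it is a sum of functions `g_S(x_S)`
over the sets `S` of at most `n` coordinates. -/
def IsGAM (n : ℕ) (f : (Fin d → ℝ) → ℝ) : Prop :=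
  ∃ g : (S : Finset (Fin d)) → (S → ℝ) → ℝ,
    ∀ x, f x = ∑ S : Finset (Fin d) with S.card ≤ n, g S (S.restrict x)

/-- The σ-algebra on `ℝ^d` generated by the sub-vector `x_S`. -/
abbrev coordSigma (S : Finset (Fin d)) : MeasurableSpace (Fin d → ℝ) :=
  MeasurableSpace.comap S.restrict MeasurableSpace.pi

/-- `v` is an observational SHAP value function of `f`, `v(x, S) = E_{z ∼ D}[f(z) | z_S = x_S]`:
each `v(·, S)` is a Borel function of `x_S` and a version of the conditional expectation
of `f` given `x_S`. -/
def IsObservationalSHAP (D : Measure (Fin d → ℝ)) (f : (Fin d → ℝ) → ℝ)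
    (v : (Fin d → ℝ) → Finset (Fin d) → ℝ) : Prop :=
  ∀ S : Finset (Fin d),
    (∃ h : (S → ℝ) → ℝ, Measurable h ∧ ∀ x, v x S = h (S.restrict x)) ∧
    (fun x => v x S) =ᵐ[D] D[f | coordSigma S]

/-- The interventional SHAP value function `v(x, S) = E_{z ∼ D}[f(z) | do(x_S)]`: the coordinates
in `S` are set to those of `x`, the other ones keep their joint distribution under `D`. -/
def interventionalSHAP (D : Measure (Fin d → ℝ)) (f : (Fin d → ℝ) → ℝ)
    (x : Fin d → ℝ) (S : Finset (Fin d)) : ℝ :=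
  ∫ z, f (S.piecewise x z) ∂D

/-- The measure of contribution `Δ_S(x)` for the value function `v`. -/
def contribution (v : (Fin d → ℝ) → Finset (Fin d) → ℝ) (x : Fin d → ℝ)
    (S : Finset (Fin d)) : ℝ :=
  ∑ T ∈ Sᶜ.powerset,
    ((d - T.card - S.card).factorial * T.card.factorial : ℝ) / ((d - S.card + 1).factorial : ℝ) *
      ∑ L ∈ S.powerset, (-1 : ℝ) ^ (S.card - L.card) * v x (L ∪ T)

/-- The `n`-Shapley Value `Φ^n_S(x)`, by recursion on `n`. It is meaningful for `|S| ≤ n`;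
for `|S| > n` it is set to `0`. The Bernoulli numbers have `B_1 = -1/2`. -/
def nShapley (v : (Fin d → ℝ) → Finset (Fin d) → ℝ) (x : Fin d → ℝ) :
    ℕ → Finset (Fin d) → ℝ
  | 0, S => if S.card = 0 then contribution v x S else 0
  | n + 1, S =>
    if S.card = n + 1 then contribution v x S
    else if S.card < n + 1 then
      nShapley v x n S + (bernoulli (n + 1 - S.card) : ℝ) *
        ∑ K ∈ Sᶜ.powerset with K.card + S.card = n + 1, contribution v x (S ∪ K)
    else 0

/-- The ordinary Shapley Value of feature `i`, by the classical Shapley formula. -/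
def shapleyValue (v : (Fin d → ℝ) → Finset (Fin d) → ℝ) (x : Fin d → ℝ) (i : Fin d) : ℝ :=
  ∑ T ∈ ({i}ᶜ : Finset (Fin d)).powerset,
    (T.card.factorial * (d - T.card - 1).factorial : ℝ) / (d.factorial : ℝ) *
      (v x (insert i T) - v x T)

/-- The functions `F_S` are the component functions of the Shapley-GAM of the value function `v`:
`F_S(x_S) = Φ^d_S(x)` for all `S` and `x`. As every point of `ℝ^S` is some `x_S`, there is at most
one such family. -/
def IsShapleyGAM (v : (Fin d → ℝ) → Finset (Fin d) → ℝ)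
    (F : (S : Finset (Fin d)) → (S → ℝ) → ℝ) : Prop :=
  ∀ (S : Finset (Fin d)) (x : Fin d → ℝ), F S (S.restrict x) = nShapley v x d S

/-- Recovery at the point `x`, for a value function `v` with Shapley-GAM `F`. -/
structure RecoveryAt (n : ℕ) (f : (Fin d → ℝ) → ℝ) (v : (Fin d → ℝ) → Finset (Fin d) → ℝ)
    (F : (S : Finset (Fin d)) → (S → ℝ) → ℝ) (x : Fin d → ℝ) : Prop where
  /-- The Shapley-GAM is a decomposition of `f`. -/
  decomposition : f x = ∑ S : Finset (Fin d), F S (S.restrict x)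
  /-- The Shapley-GAM has no components of order greater than `n`. -/
  no_higher_order : ∀ S : Finset (Fin d), n < S.card → F S (S.restrict x) = 0
  /-- The `n`-Shapley Values are the components of the Shapley-GAM. -/
  eq_component : ∀ S : Finset (Fin d), S.card ≤ n → nShapley v x n S = F S (S.restrict x)
  /-- The `n`-Shapley Values represent `f` as a GAM of order `n`. -/
  representation : f x = ∑ S : Finset (Fin d) with S.card ≤ n, nShapley v x n S

end NShap

end

/-!
The theorem reduces to an identity for the Möbius transform (Harsanyi dividends)
`a(S) = ∑_{L ⊆ S} (-1)^{|S| - |L|} v(x, L)` at a fixed point `x`.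

Möbius inversion gives `Δ_S = ∑_{R ⊆ Sᶜ} a(S ∪ R) / (|R| + 1)` (`contribution_eq_sum_dividend`).
Unrolling the recursion gives `Φ^n_S = ∑_K B_{|K|} Δ_{S ∪ K}` over `K ⊆ Sᶜ` with `|S| + |K| ≤ n`.
If the dividends of order above `n` vanish, the bound on `|K|` can be dropped, and the coefficient
of `a(S ∪ R)` in `Φ^n_S` becomes `∑_{K ⊆ R} B_{|K|} / (|R| - |K| + 1)`, which is `0` unless `R = ∅`
by the recursion of the Bernoulli numbers. Hence `Φ^n_S = a(S)` (`nShapley_eq_dividend`), and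
likewise `Φ^d_S = a(S)` for every `v`. So the Shapley-GAM is the Möbius transform of `v`; it sums to
`v(x, [d]) = f(x)`, and `f_S` depends only on `x_S`.

For the interventional value function, `a(S)` is the integral over `z` of the dividend of
`L ↦ f(x_L, z_{Lᶜ})`. If `f` is a GAM of order `n < |S|`, then the integrand vanishes at each `z`
(`IsGAM.dividend_piecewise_eq_zero`); the cancellation happens under the integral, so that no
measurability of the component functions is needed. For `n = 1` the integrand at `{i}` is
`g_i(x_i) - g_i(z_i)`.

Under independence, `(x, z) ↦ (x_S, z_{Sᶜ})` maps `D × D` to `D` (`measurePreserving_piecewise`). By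
Fubini, the interventional value function is then a version of the conditional expectation
(`interventionalSHAP_ae_eq_condExp`). So at almost every `x` an observational value function agrees
with the interventional one on all `S`, the integrals exist, and the pointwise argument applies.
-/

namespace NShap

/-! ### Möbius transforms of set functions -/

section Combinatorics

open Finset

variable {α : Type*} [DecidableEq α]

/-- The Möbius transform (Harsanyi dividend) of a set function `u`. -/
def dividend (u : Finset α → ℝ) (S : Finset α) : ℝ :=
  ∑ L ∈ S.powerset, (-1 : ℝ) ^ (S.card - L.card) * u L

theorem sum_powerset_insert_alternating (u : Finset α → ℝ) {S : Finset α} {j : α} (hj : j ∉ S) :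
    ∑ L ∈ (insert j S).powerset, (-1 : ℝ) ^ ((insert j S).card - L.card) * u L =
      ∑ L ∈ S.powerset, (-1 : ℝ) ^ (S.card - L.card) * (u (insert j L) - u L) := by
  rw [sum_powerset_insert hj, ← sum_add_distrib]
  refine sum_congr rfl fun L hL => ?_
  have hLS := mem_powerset.1 hL
  have hcard := card_le_card hLS
  rw [card_insert_of_notMem hj, card_insert_of_notMem fun h => hj (hLS h),
    Nat.add_sub_add_right, Nat.sub_add_comm hcard]
  ring

theorem dividend_eq_zero_of_insert_eq {u : Finset α → ℝ} {S : Finset α} {j : α} (hj : j ∈ S)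
    (hu : ∀ L, u (insert j L) = u L) : dividend u S = 0 := by
  rw [← insert_erase hj, dividend, sum_powerset_insert_alternating u (notMem_erase j S)]
  simp [hu]

/-- The discrete derivative of `u` in the directions `S`, at `T`, is a sum of dividends. This is
Möbius inversion if `S = ∅`. -/
theorem sum_powerset_alternating_union (u : Finset α → ℝ) (T : Finset α) :
    ∀ S : Finset α, Disjoint S T →
      ∑ L ∈ S.powerset, (-1 : ℝ) ^ (S.card - L.card) * u (L ∪ T) =
        ∑ R ∈ T.powerset, dividend u (S ∪ R) := by
  induction T using Finset.induction with
  | empty => intro S _; simp [dividend]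
  | insert j T hj ih =>
    intro S hST
    rw [disjoint_insert_right] at hST
    have h₁ := ih S hST.2
    have h₂ := ih (insert j S) (disjoint_insert_left.2 ⟨hj, hST.2⟩)
    rw [sum_powerset_insert_alternating (fun L => u (L ∪ T)) hST.1] at h₂
    simp only [mul_sub, sum_sub_distrib, insert_union] at h₂
    rw [sum_powerset_insert hj, ← h₁]
    simp only [union_insert] at h₂ ⊢
    linarith

theorem sum_dividend_powerset (u : Finset α → ℝ) (T : Finset α) :
    ∑ R ∈ T.powerset, dividend u R = u T := by
  simpa using (sum_powerset_alternating_union u T ∅ (disjoint_empty_left T)).symm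

theorem sum_powerset_powerset_comm (U : Finset α) (h : Finset α → Finset α → ℝ) :
    ∑ T ∈ U.powerset, ∑ R ∈ T.powerset, h R T =
      ∑ R ∈ U.powerset, ∑ P ∈ (U \ R).powerset, h R (R ∪ P) := by
  rw [sum_sigma', sum_sigma']
  refine sum_nbij' (fun p => ⟨p.2, p.1 \ p.2⟩) (fun p => ⟨p.1 ∪ p.2, p.1⟩) ?_ ?_ ?_ ?_ ?_
  · rintro ⟨T, R⟩ hp
    simp only [mem_sigma, mem_powerset] at hp ⊢
    exact ⟨hp.2.trans hp.1, sdiff_subset_sdiff hp.1 subset_rfl⟩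
  · rintro ⟨R, P⟩ hp
    simp only [mem_sigma, mem_powerset] at hp ⊢
    exact ⟨union_subset hp.1 (hp.2.trans sdiff_subset), subset_union_left⟩
  · rintro ⟨T, R⟩ hp
    simp only [mem_sigma, mem_powerset] at hp
    simp [union_sdiff_of_subset hp.2]
  · rintro ⟨R, P⟩ hp
    simp only [mem_sigma, mem_powerset, subset_sdiff] at hp
    simp [union_sdiff_cancel_left hp.2.2.symm]
  · rintro ⟨T, R⟩ hp
    simp only [mem_sigma, mem_powerset] at hp
    simp [union_sdiff_of_subset hp.2]

/-- The value does not depend on `P`: removing one point from `P` merges the terms `J` and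
`insert j J` to one term of the smaller sum. -/
theorem sum_powerset_factorial_mul_factorial (P : Finset α) (r : ℕ) :
    ∑ J ∈ P.powerset, ((P.card - J.card).factorial * (r + J.card).factorial : ℝ) /
      ((P.card + r + 1).factorial : ℝ) = 1 / (r + 1 : ℝ) := by
  induction P using Finset.induction with
  | empty =>
    simp [Nat.factorial_succ]
    field_simp
  | insert j P hj ih =>
    rw [sum_powerset_insert hj, ← sum_add_distrib, ← ih]
    refine sum_congr rfl fun J hJ => ?_
    have hJP := mem_powerset.1 hJ
    obtain ⟨q, hq⟩ := Nat.exists_eq_add_of_le (card_le_card hJP)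
    rw [card_insert_of_notMem hj, card_insert_of_notMem fun h => hj (hJP h), hq]
    have e₁ : J.card + q + 1 - J.card = q + 1 := by omega
    have e₂ : J.card + q + 1 - (J.card + 1) = q := by omega
    have e₃ : J.card + q - J.card = q := by omega
    have e₄ : J.card + q + 1 + r + 1 = (J.card + q + r + 1) + 1 := by omega
    rw [e₁, e₂, e₃, e₄, ← add_assoc, Nat.factorial_succ q, Nat.factorial_succ (r + J.card),
      Nat.factorial_succ (J.card + q + r + 1)]
    have : ((J.card + q + r + 1).factorial : ℝ) ≠ 0 := by positivity
    push_cast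
    field_simp
    ring

theorem sum_powerset_bernoulli_div (R : Finset α) :
    ∑ K ∈ R.powerset, (bernoulli K.card : ℝ) / (((R \ K).card : ℝ) + 1) =
      if R = ∅ then 1 else 0 := by
  have h₁ : ∀ K ∈ R.powerset, (bernoulli K.card : ℝ) / (((R \ K).card : ℝ) + 1) =
      (fun k : ℕ => (bernoulli k : ℝ) / (((R.card - k : ℕ) : ℝ) + 1)) K.card := fun K hK => by
    simp only [card_sdiff_of_subset (mem_powerset.1 hK)]
  rw [sum_congr rfl h₁,
    sum_powerset_apply_card (fun k : ℕ => (bernoulli k : ℝ) / (((R.card - k : ℕ) : ℝ) + 1))]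
  have h₂ := congrArg (fun q : ℚ => (q : ℝ)) (sum_bernoulli (R.card + 1))
  simp only [Rat.cast_sum, Rat.cast_mul, Rat.cast_natCast] at h₂
  have h₃ : ∀ k ∈ range (R.card + 1),
      R.card.choose k • ((bernoulli k : ℝ) / (((R.card - k : ℕ) : ℝ) + 1)) =
        ((R.card + 1).choose k * (bernoulli k : ℝ)) / (R.card + 1) := fun k hk => by
    have hk' : k ≤ R.card := Nat.lt_succ_iff.1 (mem_range.1 hk)
    have h := Nat.choose_mul_succ_eq R.card k
    rw [Nat.sub_add_comm hk'] at h
    have h' : (R.card.choose k : ℝ) * (R.card + 1) =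
        (R.card + 1).choose k * (((R.card - k : ℕ) : ℝ) + 1) := by exact_mod_cast h
    rw [nsmul_eq_mul, mul_div_assoc', div_eq_div_iff (by positivity) (by positivity)]
    linear_combination (bernoulli k : ℝ) * h'
  rw [sum_congr rfl h₃, ← sum_div, h₂]
  by_cases hR : R = ∅ <;> simp [hR]

end Combinatorics

/-! ### Shapley values in terms of the Möbius transform -/

section Shapley

open Finset

variable {d : ℕ} (v : (Fin d → ℝ) → Finset (Fin d) → ℝ) (x : Fin d → ℝ)

theorem contribution_eq_sum_dividend (S : Finset (Fin d)) :
    contribution v x S = ∑ K ∈ Sᶜ.powerset, dividend (v x) (S ∪ K) / ((K.card : ℝ) + 1) := by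
  have h₁ : contribution v x S = ∑ T ∈ Sᶜ.powerset, ∑ R ∈ T.powerset,
      ((d - T.card - S.card).factorial * T.card.factorial : ℝ) / ((d - S.card + 1).factorial : ℝ) *
        dividend (v x) (S ∪ R) := by
    refine sum_congr rfl fun T hT => ?_
    rw [sum_powerset_alternating_union (v x) T S
      (disjoint_of_subset_right (mem_powerset.1 hT) disjoint_compl_right), mul_sum]
  rw [h₁, sum_powerset_powerset_comm Sᶜ (fun R T =>
    ((d - T.card - S.card).factorial * T.card.factorial : ℝ) / ((d - S.card + 1).factorial : ℝ) *
        dividend (v x) (S ∪ R))]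
  refine sum_congr rfl fun R hR => ?_
  rw [← sum_mul, div_eq_mul_one_div, mul_comm,
    ← sum_powerset_factorial_mul_factorial (Sᶜ \ R) R.card]
  congr 1
  refine sum_congr rfl fun P hP => ?_
  have hP' := mem_powerset.1 hP
  have hRS := mem_powerset.1 hR
  have c₁ : (R ∪ P).card = R.card + P.card :=
    card_union_of_disjoint (disjoint_of_subset_right hP' disjoint_sdiff)
  have c₂ : (Sᶜ \ R).card = d - S.card - R.card := by
    rw [card_sdiff_of_subset hRS, card_compl, Fintype.card_fin]
  have c₃ : R.card ≤ d - S.card := by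
    simpa [card_compl] using card_le_card hRS
  rw [c₁, c₂, show d - S.card - R.card + R.card = d - S.card by omega,
    show d - (R.card + P.card) - S.card = d - S.card - R.card - P.card by omega]

theorem nShapley_eq_sum_contribution (n : ℕ) :
    ∀ S : Finset (Fin d), S.card ≤ n →
      nShapley v x n S = ∑ K ∈ Sᶜ.powerset with K.card + S.card ≤ n,
        (bernoulli K.card : ℝ) * contribution v x (S ∪ K) := by
  have hself : ∀ (n : ℕ) (S : Finset (Fin d)), S.card = n →
      ∑ K ∈ Sᶜ.powerset with K.card + S.card ≤ n,
        (bernoulli K.card : ℝ) * contribution v x (S ∪ K) = contribution v x S := by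
    intro n S hS
    have : Sᶜ.powerset.filter (fun K => K.card + S.card ≤ n) = {∅} := by
      ext K
      simp only [mem_filter, mem_powerset, mem_singleton, hS]
      constructor
      · rintro ⟨_, h⟩
        exact card_eq_zero.1 (by omega)
      · rintro rfl
        simp
    rw [this]
    simp
  induction n with
  | zero =>
    intro S hS
    have hS0 : S.card = 0 := by omega
    rw [hself 0 S hS0, nShapley, if_pos hS0]
  | succ n ih =>
    intro S hS
    rw [nShapley]
    split_ifs with h₁ h₂
    · rw [hself _ S h₁]
    · rw [ih S (by omega), mul_sum]
      have hsplit : Sᶜ.powerset.filter (fun K => K.card + S.card ≤ n + 1) =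
          Sᶜ.powerset.filter (fun K => K.card + S.card ≤ n) ∪
            Sᶜ.powerset.filter (fun K => K.card + S.card = n + 1) := by
        rw [← filter_or]
        exact filter_congr fun K _ => by omega
      rw [hsplit, sum_union (disjoint_filter.2 fun K _ h => by omega)]
      congr 1
      refine sum_congr rfl fun K hK => ?_
      rw [show n + 1 - S.card = K.card by have := (mem_filter.1 hK).2; omega]
    · omega

/-- If the dividends of order above `n` vanish, then the `n`-Shapley Values are the dividends: the
coefficient of the dividend of `S ∪ R` in `Φ^n_S` is a Bernoulli sum that vanishes for `R ≠ ∅`. -/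
theorem nShapley_eq_dividend {n : ℕ} (h : ∀ S : Finset (Fin d), n < S.card → dividend (v x) S = 0)
    {S : Finset (Fin d)} (hS : S.card ≤ n) : nShapley v x n S = dividend (v x) S := by
  have hcontr : ∀ S : Finset (Fin d), n < S.card → contribution v x S = 0 := by
    intro S hS
    rw [contribution_eq_sum_dividend]
    refine sum_eq_zero fun K _ => ?_
    rw [h _ (hS.trans_le (card_le_card subset_union_left)), zero_div]
  rw [nShapley_eq_sum_contribution v x n S hS, sum_filter_of_ne]
  · let w : Finset (Fin d) → Finset (Fin d) → ℝ := fun K R =>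
      (bernoulli K.card : ℝ) / (((R \ K).card : ℝ) + 1) * dividend (v x) (S ∪ R)
    have h₁ : ∀ K ∈ Sᶜ.powerset, (bernoulli K.card : ℝ) * contribution v x (S ∪ K) =
        ∑ P ∈ (Sᶜ \ K).powerset, w K (K ∪ P) := by
      intro K hK
      rw [contribution_eq_sum_dividend, mul_sum, compl_union, ← sdiff_eq_inter_compl]
      refine sum_congr rfl fun P hP => ?_
      have hKP : Disjoint K P := disjoint_of_subset_right (mem_powerset.1 hP) disjoint_sdiff
      simp only [w, union_sdiff_cancel_left hKP, union_assoc]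
      ring
    rw [sum_congr rfl h₁, ← sum_powerset_powerset_comm Sᶜ w]
    simp only [w, ← sum_mul, sum_powerset_bernoulli_div]
    rw [sum_eq_single ∅] <;> simp +contextual
  · intro K hK hne
    by_contra hcard
    refine hne ?_
    rw [hcontr, mul_zero]
    rw [card_union_of_disjoint
      (disjoint_of_subset_right (mem_powerset.1 hK) disjoint_compl_right)]
    omega

theorem nShapley_dim_eq_dividend (S : Finset (Fin d)) :
    nShapley v x d S = dividend (v x) S :=
  nShapley_eq_dividend v x (fun S hS => absurd (card_finset_fin_le S) (by omega))
    (card_finset_fin_le S)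

theorem shapleyValue_eq_contribution (i : Fin d) : shapleyValue v x i = contribution v x {i} := by
  refine sum_congr rfl fun T _ => ?_
  have hd : d - 1 + 1 = d := Nat.sub_add_cancel i.pos
  rw [← insert_empty_eq, sum_powerset_insert_alternating (fun L => v x (L ∪ T)) (notMem_empty i)]
  simp [hd, mul_comm]

theorem shapleyValue_eq_nShapley_one (i : Fin d) : shapleyValue v x i = nShapley v x 1 {i} := by
  rw [shapleyValue_eq_contribution, nShapley, if_pos (card_singleton i)]

/-- As `Φ^d_S(x)` is the dividend of `S`, it involves only the values `v(x, L)` with `L ⊆ S`. -/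
theorem exists_isShapleyGAM
    (hv : ∀ S : Finset (Fin d), ∃ h : (S → ℝ) → ℝ, ∀ x, v x S = h (S.restrict x)) :
    ∃ F : (S : Finset (Fin d)) → (S → ℝ) → ℝ, IsShapleyGAM v F := by
  choose h hh using hv
  refine ⟨fun S y => nShapley v (fun i => if hi : i ∈ S then y ⟨i, hi⟩ else 0) d S, fun S x => ?_⟩
  simp only [nShapley_dim_eq_dividend]
  refine sum_congr rfl fun L hL => ?_
  rw [hh, hh]
  congr 2
  funext i
  simp [mem_powerset.1 hL i.2]

end Shapley

/-! ### Recovery at a point where the value function is interventional -/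

section Pointwise

open Finset

variable {d n : ℕ} {D : Measure (Fin d → ℝ)} {f : (Fin d → ℝ) → ℝ}
  {v : (Fin d → ℝ) → Finset (Fin d) → ℝ} {x : Fin d → ℝ}

/-- In each summand `g_T`, replacing a coordinate `j ∉ T` of `z` by that of `x` changes nothing. -/
theorem IsGAM.dividend_piecewise_eq_zero (hf : IsGAM n f) (x z : Fin d → ℝ)
    {S : Finset (Fin d)} (hS : n < S.card) : dividend (fun L => f (L.piecewise x z)) S = 0 := by
  obtain ⟨g, hg⟩ := hf
  have h₁ : dividend (fun L => f (L.piecewise x z)) S =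
      ∑ T : Finset (Fin d) with T.card ≤ n,
        dividend (fun L => g T (T.restrict (L.piecewise x z))) S := by
    simp only [dividend, hg, mul_sum]
    exact sum_comm
  rw [h₁]
  refine sum_eq_zero fun T hT => ?_
  obtain ⟨j, hjS, hjT⟩ := exists_mem_notMem_of_card_lt_card ((mem_filter.1 hT).2.trans_lt hS)
  refine dividend_eq_zero_of_insert_eq hjS fun L => ?_
  congr 1
  funext i
  have hij : (i : Fin d) ≠ j := fun h => hjT (h ▸ i.2)
  simp [Finset.piecewise, hij]

theorem dividend_eq_integral
    (hint : ∀ S : Finset (Fin d), Integrable (fun z => f (S.piecewise x z)) D)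
    (hv : ∀ S, v x S = interventionalSHAP D f x S) (S : Finset (Fin d)) :
    dividend (v x) S = ∫ z, dividend (fun L => f (L.piecewise x z)) S ∂D := by
  simp only [dividend]
  rw [integral_finsetSum _ fun L _ => (hint L).const_mul _]
  exact sum_congr rfl fun L _ => by rw [integral_const_mul, hv, interventionalSHAP]

theorem recoveryAt_of_eq_interventionalSHAP [IsProbabilityMeasure D] (hf : IsGAM n f)
    (hint : ∀ S : Finset (Fin d), Integrable (fun z => f (S.piecewise x z)) D)
    (hv : ∀ S, v x S = interventionalSHAP D f x S)
    {F : (S : Finset (Fin d)) → (S → ℝ) → ℝ} (hF : IsShapleyGAM v F) :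
    RecoveryAt n f v F x := by
  have hzero : ∀ S : Finset (Fin d), n < S.card → dividend (v x) S = 0 := fun S hS => by
    simp [dividend_eq_integral hint hv, hf.dividend_piecewise_eq_zero x _ hS]
  have hcomp : ∀ S, F S (S.restrict x) = dividend (v x) S := fun S => by
    rw [hF, nShapley_dim_eq_dividend]
  have hfx : f x = ∑ S, dividend (v x) S := by
    have h := sum_dividend_powerset (v x) univ
    rw [powerset_univ, hv, interventionalSHAP] at h
    simpa using h.symm
  refine ⟨by simpa only [hcomp] using hfx, fun S hS => (hcomp S).trans (hzero S hS),
    fun S hS => (nShapley_eq_dividend v x hzero hS).trans (hcomp S).symm, ?_⟩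
  rw [hfx, sum_congr rfl fun S hS => nShapley_eq_dividend v x hzero (mem_filter.1 hS).2,
    sum_filter_of_ne]
  intro S _ hne
  by_contra hS
  exact hne (hzero S (not_le.1 hS))

theorem RecoveryAt.shapleyValue_eq {F : (S : Finset (Fin d)) → (S → ℝ) → ℝ}
    (h : RecoveryAt 1 f v F x) (i : Fin d) :
    shapleyValue v x i = F {i} (({i} : Finset (Fin d)).restrict x) := by
  rw [shapleyValue_eq_nShapley_one, h.eq_component _ (card_singleton i).le]

theorem integrable_of_additive [IsFiniteMeasure D] {c : ℝ} {g : Fin d → ℝ → ℝ}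
    (hg : ∀ x, f x = c + ∑ i, g i (x i)) (i : Fin d)
    (hint : Integrable (fun z => f (({i}ᶜ : Finset (Fin d)).piecewise x z)) D) :
    Integrable (fun z => g i (z i)) D := by
  have h : (fun z : Fin d → ℝ => g i (z i)) = fun z => f (({i}ᶜ : Finset (Fin d)).piecewise x z) -
      (c + ∑ j ∈ univ.erase i, g j (x j)) := by
    funext z
    rw [hg, ← add_sum_erase univ _ (mem_univ i), sum_congr rfl fun j hj => by
      rw [piecewise_eq_of_mem _ _ _ (by simpa using ne_of_mem_erase hj)],
      piecewise_eq_of_notMem _ _ _ (by simp)]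
    ring
  rw [h]
  exact hint.sub (integrable_const _)

theorem shapleyValue_of_additive [IsProbabilityMeasure D] (hf : IsGAM 1 f)
    (hint : ∀ S : Finset (Fin d), Integrable (fun z => f (S.piecewise x z)) D)
    (hv : ∀ S, v x S = interventionalSHAP D f x S) {c : ℝ} {g : Fin d → ℝ → ℝ}
    (hg : ∀ x, f x = c + ∑ i, g i (x i)) (i : Fin d) :
    shapleyValue v x i = g i (x i) - ∫ z, g i (z i) ∂D := by
  have hzero : ∀ S : Finset (Fin d), 1 < S.card → dividend (v x) S = 0 := fun S hS => by
    simp [dividend_eq_integral hint hv, hf.dividend_piecewise_eq_zero x _ hS]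
  have hdiv : ∀ z : Fin d → ℝ,
      dividend (fun L => f (L.piecewise x z)) {i} = g i (x i) - g i (z i) := fun z => by
    rw [← insert_empty_eq, dividend, sum_powerset_insert_alternating _ (notMem_empty i)]
    simp only [powerset_empty, sum_singleton, insert_empty_eq, card_empty, hg]
    rw [← add_sum_erase univ _ (mem_univ i), ← add_sum_erase univ (fun j => g j _) (mem_univ i),
      sum_congr rfl fun j hj => by
        rw [piecewise_eq_of_notMem _ _ _ (by simpa using ne_of_mem_erase hj)]]
    simp only [piecewise_singleton, Function.update_self, piecewise_empty]
    ring
  rw [shapleyValue_eq_nShapley_one, nShapley_eq_dividend v x hzero (card_singleton i).le,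
    dividend_eq_integral hint hv]
  simp only [hdiv]
  rw [integral_sub (integrable_const _) (integrable_of_additive hg i (hint _))]
  simp

end Pointwise

/-! ### Conditional expectations under independence -/

section Independence

variable {d : ℕ} {D : Measure (Fin d → ℝ)} [IsProbabilityMeasure D]

theorem measurePreserving_piecewise (hD : iIndepFun (fun (i : Fin d) (x : Fin d → ℝ) => x i) D)
    (S : Finset (Fin d)) :
    MeasurePreserving (fun p : (Fin d → ℝ) × (Fin d → ℝ) => S.piecewise p.1 p.2) (D.prod D) D := by
  have hmeas : Measurable fun p : (Fin d → ℝ) × (Fin d → ℝ) => S.piecewise p.1 p.2 := by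
    refine measurable_pi_lambda _ fun i => ?_
    by_cases hi : i ∈ S <;> simp only [Finset.piecewise, hi, if_true, if_false] <;> fun_prop
  refine ⟨hmeas, ?_⟩
  let μ : Fin d → Measure ℝ := fun i => D.map fun x => x i
  have hμ : ∀ i, IsProbabilityMeasure (μ i) := fun i =>
    Measure.isProbabilityMeasure_map (measurable_pi_apply i).aemeasurable
  have hpi : D = Measure.pi μ := by
    simpa using hD.map_fun_eq_pi_map fun i => (measurable_pi_apply i).aemeasurable
  suffices h : Measure.pi μ = (D.prod D).map fun p => S.piecewise p.1 p.2 by rw [← h, ← hpi]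
  refine Measure.pi_eq fun s hs => ?_
  have hpre : (fun p : (Fin d → ℝ) × (Fin d → ℝ) => S.piecewise p.1 p.2) ⁻¹' Set.univ.pi s =
      (Set.univ.pi fun i => if i ∈ S then s i else Set.univ) ×ˢ
        (Set.univ.pi fun i => if i ∈ S then Set.univ else s i) := by
    ext p
    simp only [Set.mem_preimage, Set.mem_univ_pi, Set.mem_prod, ← forall_and]
    refine forall_congr' fun i => ?_
    by_cases hi : i ∈ S <;> simp [hi]
  rw [Measure.map_apply hmeas (.univ_pi hs), hpre, Measure.prod_prod, hpi, Measure.pi_pi,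
    Measure.pi_pi, ← Finset.prod_mul_distrib]
  refine Finset.prod_congr rfl fun i _ => ?_
  by_cases hi : i ∈ S <;> simp [hi]

theorem ae_integrable_piecewise (hD : iIndepFun (fun (i : Fin d) (x : Fin d → ℝ) => x i) D)
    {f : (Fin d → ℝ) → ℝ} (hf : Integrable f D) (S : Finset (Fin d)) :
    ∀ᵐ x ∂D, Integrable (fun z => f (S.piecewise x z)) D :=
  ((measurePreserving_piecewise hD S).integrable_comp_of_integrable hf).prod_right_ae

/-- `interventionalSHAP D f · S` need not be measurable where `f` is only almost everywhere
measurable, so it is compared with the one of a measurable representative `f'` of `f`. -/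
theorem aestronglyMeasurable_interventionalSHAP
    (hD : iIndepFun (fun (i : Fin d) (x : Fin d → ℝ) => x i) D)
    {f : (Fin d → ℝ) → ℝ} (hf : AEStronglyMeasurable f D) (S : Finset (Fin d)) :
    AEStronglyMeasurable[coordSigma S] (fun x => interventionalSHAP D f x S) D := by
  obtain ⟨f', hf', hff'⟩ := hf
  let ψ : (S → ℝ) × (Fin d → ℝ) → Fin d → ℝ :=
    fun p i => if hi : i ∈ S then p.1 ⟨i, hi⟩ else p.2 i
  have hψ : Measurable ψ := by
    refine measurable_pi_lambda _ fun i => ?_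
    by_cases hi : i ∈ S <;> simp only [ψ, hi, dite_true, dite_false] <;> fun_prop
  have hψS : ∀ x z, ψ (S.restrict x, z) = S.piecewise x z := fun x z => by
    funext i
    simp [ψ, Finset.piecewise]
  have hmeas : StronglyMeasurable fun y : S → ℝ => ∫ z, f' (ψ (y, z)) ∂D :=
    (hf'.comp_measurable hψ).integral_prod_right'
  refine ⟨fun x => ∫ z, f' (ψ (S.restrict x, z)) ∂D,
    hmeas.comp_measurable (comap_measurable _), ?_⟩
  have h := (measurePreserving_piecewise hD S).quasiMeasurePreserving.ae_eq_comp hff'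
  filter_upwards [Measure.ae_ae_of_ae_prod h] with x hx
  simp only [interventionalSHAP, hψS]
  exact integral_congr_ae hx

theorem interventionalSHAP_ae_eq_condExp
    (hD : iIndepFun (fun (i : Fin d) (x : Fin d → ℝ) => x i) D)
    {f : (Fin d → ℝ) → ℝ} (hf : Integrable f D) (S : Finset (Fin d)) :
    (fun x => interventionalSHAP D f x S) =ᵐ[D] D[f | coordSigma S] := by
  have hm : coordSigma S ≤ MeasurableSpace.pi :=
    Measurable.comap_le (Finset.measurable_restrict S)
  have hφ := measurePreserving_piecewise hD S
  have hint := hφ.integrable_comp_of_integrable hf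
  refine ae_eq_condExp_of_forall_setIntegral_eq hm hf
    (fun s _ _ => hint.integral_prod_left.integrableOn) ?_
    (aestronglyMeasurable_interventionalSHAP hD hf.1 S)
  rintro s ⟨t, ht, rfl⟩ -
  -- `S.piecewise x z` has the same `S`-coordinates as `x`
  have hpre : (fun p : (Fin d → ℝ) × (Fin d → ℝ) => S.piecewise p.1 p.2) ⁻¹' (S.restrict ⁻¹' t) =
      (S.restrict ⁻¹' t) ×ˢ Set.univ := by
    ext p
    have : S.restrict (S.piecewise p.1 p.2) = S.restrict p.1 := by
      funext i
      simp
    simp [this]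
  have h := setIntegral_map (μ := D.prod D) (f := f)
    (g := fun p : (Fin d → ℝ) × (Fin d → ℝ) => S.piecewise p.1 p.2)
    (Finset.measurable_restrict S ht) (by rw [hφ.map_eq]; exact hf.1) hφ.aemeasurable
  rw [hφ.map_eq, hpre, setIntegral_prod (fun p => f (S.piecewise p.1 p.2)) hint.integrableOn] at h
  simpa [interventionalSHAP] using h.symm

theorem IsObservationalSHAP.ae_eq_interventionalSHAP
    (hD : iIndepFun (fun (i : Fin d) (x : Fin d → ℝ) => x i) D)
    {f : (Fin d → ℝ) → ℝ} (hf : Integrable f D) {v : (Fin d → ℝ) → Finset (Fin d) → ℝ}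
    (hv : IsObservationalSHAP D f v) :
    ∀ᵐ x ∂D, ∀ S, v x S = interventionalSHAP D f x S :=
  ae_all_iff.2 fun S => (hv S).2.trans (interventionalSHAP_ae_eq_condExp hD hf S).symm

end Independence

end NShap

/-! ### Recovery of generalized additive models -/

theorem theorem4 (d n : ℕ) (hn : 1 ≤ n) (hnd : n ≤ d)
    (D : Measure (Fin d → ℝ)) [IsProbabilityMeasure D]
    (f : (Fin d → ℝ) → ℝ) (hf : NShap.IsGAM n f) :
    -- (a) observational SHAP with independent features
    (Integrable f D → iIndepFun (fun (i : Fin d) (x : Fin d → ℝ) => x i) D →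
      ∀ v : (Fin d → ℝ) → Finset (Fin d) → ℝ, NShap.IsObservationalSHAP D f v →
        ∃ F : (S : Finset (Fin d)) → (S → ℝ) → ℝ, NShap.IsShapleyGAM v F ∧
          (∀ᵐ x ∂D, NShap.RecoveryAt n f v F x) ∧
          -- the case of Glassbox-GAMs and ordinary Shapley Values
          (n = 1 →
            (∀ᵐ x ∂D, ∀ i : Fin d,
              NShap.shapleyValue v x i = F {i} (({i} : Finset (Fin d)).restrict x)) ∧
            ∀ (c : ℝ) (g : Fin d → ℝ → ℝ), (∀ x, f x = c + ∑ i, g i (x i)) →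
              ∀ i : Fin d, Integrable (fun z => g i (z i)) D ∧
                ∀ᵐ x ∂D, NShap.shapleyValue v x i = g i (x i) - ∫ z, g i (z i) ∂D)) ∧
    -- (b) interventional SHAP
    ((∀ (x : Fin d → ℝ) (S : Finset (Fin d)), Integrable (fun z => f (S.piecewise x z)) D) →
      ∃ F : (S : Finset (Fin d)) → (S → ℝ) → ℝ,
        NShap.IsShapleyGAM (NShap.interventionalSHAP D f) F ∧
          (∀ x, NShap.RecoveryAt n f (NShap.interventionalSHAP D f) F x) ∧
          -- the case of Glassbox-GAMs and ordinary Shapley Values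
          (n = 1 →
            (∀ (x : Fin d → ℝ) (i : Fin d), NShap.shapleyValue (NShap.interventionalSHAP D f) x i
              = F {i} (({i} : Finset (Fin d)).restrict x)) ∧
            ∀ (c : ℝ) (g : Fin d → ℝ → ℝ), (∀ x, f x = c + ∑ i, g i (x i)) →
              ∀ i : Fin d, Integrable (fun z => g i (z i)) D ∧
                ∀ x, NShap.shapleyValue (NShap.interventionalSHAP D f) x i
                  = g i (x i) - ∫ z, g i (z i) ∂D)) := by

  refine ⟨fun hint hD v hv => ?_, fun hint => ?_⟩
  · obtain ⟨F, hF⟩ := NShap.exists_isShapleyGAM v fun S =>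
      let ⟨h, _, hh⟩ := (hv S).1
      ⟨h, hh⟩
    have hae := (ae_all_iff.2 (NShap.ae_integrable_piecewise hD hint)).and
      (hv.ae_eq_interventionalSHAP hD hint)
    have hrec : ∀ᵐ x ∂D, NShap.RecoveryAt n f v F x := hae.mono fun x hx =>
      NShap.recoveryAt_of_eq_interventionalSHAP hf hx.1 hx.2 hF
    refine ⟨F, hF, hrec, ?_⟩
    rintro rfl
    refine ⟨hrec.mono fun x hx i => hx.shapleyValue_eq i, fun c g hg i => ?_⟩
    obtain ⟨x, hx⟩ := hae.exists
    exact ⟨NShap.integrable_of_additive hg i (hx.1 _), hae.mono fun x hx =>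
      NShap.shapleyValue_of_additive hf hx.1 hx.2 hg i⟩
  · obtain ⟨F, hF⟩ := NShap.exists_isShapleyGAM (NShap.interventionalSHAP D f) fun S => by
      refine ⟨fun y => NShap.interventionalSHAP D f
        (fun i => if hi : i ∈ S then y ⟨i, hi⟩ else 0) S, fun x => ?_⟩
      have h : ∀ z : Fin d → ℝ, S.piecewise x z =
          S.piecewise (fun i => if i ∈ S then x i else 0) z := fun z => by
        funext i
        by_cases hi : i ∈ S <;> simp [hi]
      simp [NShap.interventionalSHAP, ← h]
    have hrec : ∀ x, NShap.RecoveryAt n f (NShap.interventionalSHAP D f) F x := fun x =>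
      NShap.recoveryAt_of_eq_interventionalSHAP hf (hint x) (fun _ => rfl) hF
    refine ⟨F, hF, hrec, ?_⟩
    rintro rfl
    exact ⟨fun x i => (hrec x).shapleyValue_eq i, fun c g hg i =>
      ⟨NShap.integrable_of_additive hg i (hint 0 _), fun x =>
        NShap.shapleyValue_of_additive hf (hint x) (fun _ => rfl) hg i⟩⟩
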